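/- Let $\Bbbk$ be a field and let $A$ be a profinite $\Bbbk$-algebra, i.e. an associative unital $\Bbbk$-algebra that is isomorphic to an inverse limit of finite-dimensional $\Bbbk$-algebras (over a directed index set, with algebra homomorphisms as transition maps). Then the following are equivalent: (i) every finitely generated left $A$-module embeds in a free left $A$-module; (ii) every cyclic left $A$-module embeds in a free left $A$-module; (iii) $A$ is finite-dimensional over $\Bbbk$ and is a quasi-Frobenius (QF) ring, i.e. $A$ is left or right self-injective and left or right artinian. -/

import Mathlib

universe u v w

/-- The inverse limit of a system of `k`-algebras `F i` with transition maps `f : F j → F i` for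
`i ≤ j`: the subalgebra of compatible families in the product. -/
def algebraInverseLimit {k : Type v} [Field k] {ι : Type w} [Preorder ι] {F : ι → Type u}
    [∀ i, Ring (F i)] [∀ i, Algebra k (F i)] (f : ∀ ⦃i j : ι⦄, i ≤ j → F j →ₐ[k] F i) :
    Subalgebra k (∀ i, F i) where
  carrier := {x | ∀ ⦃i j : ι⦄ (h : i ≤ j), f h (x j) = x i}
  mul_mem' hx hy i j h := by simp [hx h, hy h]
  add_mem' hx hy i j h := by simp [hx h, hy h]
  algebraMap_mem' r i j h := by simp

/-- A `k`-algebra is profinite if it is isomorphic to the inverse limit of an inverse system of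
finite dimensional `k`-algebras over a nonempty directed preordered set.
The universe of `A` suffices for the system: the `F i` may be replaced by the images of `A`
in them, and the index set by the set of kernels of the maps `A → F i`. -/
def IsProfiniteAlgebra (k : Type v) (A : Type u) [Field k] [Ring A] [Algebra k A] : Prop :=
  ∃ (ι : Type u) (_ : Preorder ι) (_ : Nonempty ι) (_ : IsDirectedOrder ι)
    (F : ι → Type u) (_ : ∀ i, Ring (F i)) (_ : ∀ i, Algebra k (F i))
    (f : ∀ ⦃i j : ι⦄, i ≤ j → F j →ₐ[k] F i),
    (∀ i, FiniteDimensional k (F i)) ∧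
    InverseSystem (fun ⦃i j : ι⦄ (h : i ≤ j) => (f h : F j → F i)) ∧
    Nonempty (A ≃ₐ[k] algebraInverseLimit f)

/-- The module `M` embeds in a free module. A finitely generated module which embeds in
some free module embeds in one of finite rank, so the universe restriction is harmless for it. -/
def EmbedsInFree (R : Type u) (M : Type u) [Ring R] [AddCommGroup M] [Module R M] : Prop :=
  ∃ (F : Type u) (_ : AddCommGroup F) (_ : Module R F),
    Module.Free R F ∧ ∃ g : M →ₗ[R] F, Function.Injective g

/-- A ring is quasi-Frobenius if it is left or right self-injective and left or right artinian.
Right `R`-modules are modules over the opposite ring `Rᵐᵒᵖ`. -/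
def IsQuasiFrobenius (R : Type u) [Ring R] : Prop :=
  (Module.Injective R R ∨ Module.Injective Rᵐᵒᵖ R) ∧ (IsArtinian R R ∨ IsArtinian Rᵐᵒᵖ R)

/-! Everything passes through one condition: each left ideal of A is a left annihilator. Embedding
the cyclic modules A/I in free modules gives it.

Finite dimension: left annihilators are closed in the profinite topology. If every ker π_i contained
some t ≠ 0 with At finite-dimensional, one could choose such t_m tending to 0 so fast that Σ t_m
lies in the closure of the left ideal they generate but not in that ideal. So some ker π_i contains
no such t. If ker π_j is the annihilator of s and x ∈ s, then Ax is a quotient of A/ker π_j, so (ker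
π_i)x consists of elements of ker π_i generating finite-dimensional left ideals and vanishes. Thus
ker π_i ⊆ ker π_j for all j, and π_i is injective.

Self-injectivity: each simple module embeds in A and is the socle of a uniform direct summand X_c of
A. By Fitting's lemma X_c has a unique maximal submodule, and its simple quotient determines X_c.
There are finitely many simples, so by counting each occurs as such a quotient. For P = ∏ X_c this
gives dim Hom(M,P) ≤ dim Hom(P,M) for simple M, hence for all finite-dimensional M. Equality at M =
Pⁿ forces maps to P from submodules of Pⁿ to extend, and A is a summand of Pⁿ.

Conversely, self-injectivity on one side yields the annihilator condition on the other, hence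
self-injectivity there too. Finitely generated modules then embed in some Aⁿ by shrinking kernels.
-/

/-- Every left ideal of `R` is the left annihilator of a subset of `R`. -/
def LeftIdealsAreAnnihilators (R : Type u) [Ring R] : Prop :=
  ∀ I : Submodule R R, ∃ s : Set R, ∀ a, a ∈ I ↔ ∀ x ∈ s, a * x = 0

/-- The annihilating set consists of the coordinates, in a basis, of the image of the generator 1 +
I. -/
theorem leftIdealsAreAnnihilators_of_cyclic {R : Type u} [Ring R]
    (h : ∀ (M : Type u) [AddCommGroup M] [Module R M],
      (∃ m : M, Submodule.span R {m} = ⊤) → EmbedsInFree R M) :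
    LeftIdealsAreAnnihilators R := by
  intro I
  obtain ⟨F, _, _, _, g, hg⟩ := h (R ⧸ I) ⟨I.mkQ 1, by
    rw [← Set.image_singleton, ← Submodule.map_span, show Submodule.span R {(1 : R)} = ⊤ from
      Ideal.span_singleton_one, Submodule.map_top, Submodule.range_mkQ]⟩
  let b := Module.Free.chooseBasis R F
  refine ⟨Set.range fun i => b.repr (g (I.mkQ 1)) i, fun a => ?_⟩
  have h1 : I.mkQ a = a • I.mkQ 1 := by rw [← map_smul]; simp
  rw [← Submodule.Quotient.mk_eq_zero I, ← Submodule.mkQ_apply, ← map_eq_zero_iff g hg, h1,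
    map_smul, ← map_eq_zero_iff b.repr b.repr.injective, map_smul, Finsupp.ext_iff]
  simp

/-! ### Profinite algebras: closed ideals and finite dimension -/

/-- The projections of a profinite algebra to a defining system of finite dimensional algebras:
they are directed, jointly injective, and every element of the double dual of `A` is represented
on the continuous functionals by an element of `A`. -/
theorem IsProfiniteAlgebra.exists_projections {k : Type v} {A : Type u} [Field k] [Ring A]
    [Algebra k A] (hA : IsProfiniteAlgebra k A) :
    ∃ (ι : Type u) (_ : Preorder ι) (_ : Nonempty ι) (_ : IsDirectedOrder ι)
      (F : ι → Type u) (_ : ∀ i, Ring (F i)) (_ : ∀ i, Algebra k (F i)) (π : ∀ i, A →ₐ[k] F i),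
      (∀ i, FiniteDimensional k (F i)) ∧
      (∀ ⦃i j⦄, i ≤ j → ∀ a, π j a = 0 → π i a = 0) ∧
      (∀ a, (∀ i, π i a = 0) → a = 0) ∧
      ∀ φ : Module.Dual k (Module.Dual k A), ∃ a, ∀ i (c : Module.Dual k (F i)),
        φ (c ∘ₗ (π i).toLinearMap) = c (π i a) := by
  obtain ⟨ι, _, _, _, F, _, _, f, hF, -, ⟨e⟩⟩ := hA
  have hcomp : ∀ ⦃i j : ι⦄ (h : i ≤ j) (a : A), f h ((e a).1 j) = (e a).1 i :=
    fun i j h a => (e a).2 h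
  let π : ∀ i, A →ₐ[k] F i := fun i =>
    ((Pi.evalAlgHom k F i).comp (algebraInverseLimit f).val).comp e.toAlgHom
  have hπ : ∀ i a, π i a = (e a).1 i := fun _ _ => rfl
  refine ⟨ι, inferInstance, inferInstance, inferInstance, F, inferInstance, inferInstance, π, hF,
    ?_, ?_, ?_⟩
  · intro i j h a ha
    rw [hπ] at ha ⊢
    rw [← hcomp h, ha, map_zero]
  · intro a ha
    apply e.injective
    rw [map_zero]
    ext i
    exact ha i
  · intro φ
    -- Each `F i` is finite-dimensional, hence reflexive; the representing elements are compatible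
    -- because functionals separate points.
    have hrep : ∀ i, ∃ b : F i, ∀ c : Module.Dual k (F i), φ (c ∘ₗ (π i).toLinearMap) = c b := by
      intro i
      let ψ : Module.Dual k (Module.Dual k (F i)) := φ ∘ₗ (π i).toLinearMap.dualMap
      refine ⟨(Module.evalEquiv k (F i)).symm ψ, fun c => ?_⟩
      exact LinearMap.congr_fun ((Module.evalEquiv k (F i)).apply_symm_apply ψ).symm c
    choose b hb using hrep
    have hbf : b ∈ algebraInverseLimit f := by
      intro i j h
      rw [← sub_eq_zero, ← Module.forall_dual_apply_eq_zero_iff k]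
      intro c
      rw [map_sub, sub_eq_zero, ← hb i c]
      have := hb j (c ∘ₗ (f h).toLinearMap)
      simp only [LinearMap.comp_apply, AlgHom.toLinearMap_apply] at this
      rw [← this]
      congr 1
      ext a
      simp [hπ, hcomp h]
    refine ⟨e.symm ⟨b, hbf⟩, fun i c => ?_⟩
    rw [hb i c, hπ, AlgEquiv.apply_symm_apply]

/-- A linear extension to all sequences of the sum of finitely supported ones. It replaces
convergence in the construction of infinite sums. -/
theorem exists_summation_functional (k : Type v) [Field k] :
    ∃ Λ : (ℕ → k) →ₗ[k] k, ∀ (f : ℕ → k) (n : ℕ), (∀ m, n ≤ m → f m = 0) →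
      Λ f = ∑ m ∈ Finset.range n, f m := by
  have hinj : LinearMap.ker (Finsupp.lcoeFun : (ℕ →₀ k) →ₗ[k] ℕ → k) = ⊥ :=
    LinearMap.ker_eq_bot.mpr DFunLike.coe_injective
  obtain ⟨g, hg⟩ := LinearMap.exists_leftInverse_of_injective _ hinj
  refine ⟨Finsupp.linearCombination k (fun _ => (1 : k)) ∘ₗ g, fun f n hf => ?_⟩
  let f' : ℕ →₀ k := Finsupp.onFinset (Finset.range n) f fun m hm => by
    by_contra h
    exact hm (hf m (by simpa using h))
  have h1 : g f = f' := LinearMap.congr_fun hg f'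
  rw [LinearMap.comp_apply, h1, Finsupp.linearCombination_apply,
    Finsupp.sum_of_support_subset f' Finsupp.support_onFinset_subset _ (by simp)]
  simp [f']

theorem finiteDimensional_range_of_ker_le {k V W U : Type*} [Field k] [AddCommGroup V]
    [AddCommGroup W] [AddCommGroup U] [Module k V] [Module k W] [Module k U]
    [FiniteDimensional k U] (g : V →ₗ[k] U) (f : V →ₗ[k] W)
    (h : LinearMap.ker g ≤ LinearMap.ker f) : FiniteDimensional k (LinearMap.range f) := by
  have : FiniteDimensional k (V ⧸ LinearMap.ker g) :=
    Module.Finite.equiv g.quotKerEquivRange.symm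
  rw [← Submodule.range_liftQ _ f h]
  infer_instance

section Projections

variable {k : Type v} {A : Type u} [Field k] [Ring A] [Algebra k A] {ι : Type u} [Preorder ι]
  [IsDirectedOrder ι] {F : ι → Type u} [∀ i, Ring (F i)] [∀ i, Algebra k (F i)]
  (π : ∀ i, A →ₐ[k] F i)

/-- While V ∩ ker π_i is nonzero, directedness gives a larger index that strictly shrinks it. -/
theorem exists_projection_injOn
    (hmono : ∀ ⦃i j⦄, i ≤ j → ∀ a, π j a = 0 → π i a = 0)
    (hsep : ∀ a, (∀ i, π i a = 0) → a = 0)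
    (V : Submodule k A) [FiniteDimensional k V] (i : ι) :
    ∃ j, i ≤ j ∧ ∀ v ∈ V, π j v = 0 → v = 0 := by
  induction h : Module.finrank k ↥(V ⊓ LinearMap.ker (π i).toLinearMap) using
    Nat.strong_induction_on generalizing i with
  | _ n ih =>
    by_cases hi : ∀ v ∈ V, π i v = 0 → v = 0
    · exact ⟨i, le_rfl, hi⟩
    · push Not at hi
      obtain ⟨v, hv, hiv, hv0⟩ := hi
      have : ∃ j, π j v ≠ 0 := by
        by_contra! hc
        exact hv0 (hsep v hc)
      obtain ⟨j, hj⟩ := this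
      obtain ⟨l, hil, hjl⟩ := exists_ge_ge i j
      have hlt : V ⊓ LinearMap.ker (π l).toLinearMap < V ⊓ LinearMap.ker (π i).toLinearMap := by
        refine lt_of_le_of_ne (fun x hx => ⟨hx.1, hmono hil x hx.2⟩) fun he => ?_
        have hm : v ∈ V ⊓ LinearMap.ker (π l).toLinearMap := he ▸ ⟨hv, hiv⟩
        exact hj (hmono hjl v hm.2)
      obtain ⟨m, hlm, hm⟩ := ih _ (h ▸ Submodule.finrank_lt_finrank_of_lt hlt) l rfl
      exact ⟨m, hil.trans hlm, hm⟩

theorem exists_projection_no_finiteDimensional_ideal [Nonempty ι]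
    (hmono : ∀ ⦃i j⦄, i ≤ j → ∀ a, π j a = 0 → π i a = 0)
    (hsep : ∀ a, (∀ i, π i a = 0) → a = 0)
    (hcompl : ∀ φ : Module.Dual k (Module.Dual k A), ∃ a, ∀ i (c : Module.Dual k (F i)),
        φ (c ∘ₗ (π i).toLinearMap) = c (π i a))
    (hann : LeftIdealsAreAnnihilators A) :
    ∃ i, ∀ t, π i t = 0 → FiniteDimensional k (Submodule.span A {t}) → t = 0 := by
  by_contra! hcon
  -- A state (i, V) has V finite-dimensional and π_i injective on V. A step picks t ∈ ker π_i,
  -- adjoins At to V and enlarges i.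
  let State := {p : ι × Submodule A A //
    FiniteDimensional k p.2 ∧ ∀ v ∈ p.2, π p.1 v = 0 → v = 0}
  have hstep : ∀ p : State, ∃ (t : A) (q : State), t ≠ 0 ∧ π p.1.1 t = 0 ∧ p.1.1 ≤ q.1.1 ∧
      q.1.2 = p.1.2 ⊔ Submodule.span A {t} := by
    rintro ⟨⟨i, V⟩, hV, hinj⟩
    obtain ⟨t, hit, hfin, ht⟩ := hcon i
    have hfin' : FiniteDimensional k ↥((V ⊔ Submodule.span A {t}).restrictScalars k) := by
      rw [Submodule.restrictScalars_sup]
      have h1 : FiniteDimensional k ↥(V.restrictScalars k) := hV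
      have h2 : FiniteDimensional k ↥((Submodule.span A {t}).restrictScalars k) := hfin
      infer_instance
    obtain ⟨j, hij, hj⟩ := exists_projection_injOn π hmono hsep
      ((V ⊔ Submodule.span A {t}).restrictScalars k) i
    exact ⟨t, ⟨⟨j, V ⊔ Submodule.span A {t}⟩, hfin', hj⟩, ht, hit, hij, rfl⟩
  choose T next hT0 hTπ hle hsup using hstep
  let σ : ℕ → State := fun n => Nat.rec
    ⟨⟨Classical.arbitrary ι, ⊥⟩, by dsimp only; infer_instance,
      fun v hv _ => by simpa using hv⟩ (fun _ => next) n
  have hσ : ∀ n, σ (n + 1) = next (σ n) := fun _ => rfl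
  let t : ℕ → A := fun n => T (σ n)
  have hVs : ∀ n, (σ (n + 1)).1.2 = (σ n).1.2 ⊔ Submodule.span A {t n} := fun n => hsup (σ n)
  have hVmono : Monotone fun n => (σ n).1.2 :=
    monotone_nat_of_le_succ fun n => (hVs n).ge.trans' le_sup_left
  have himono : Monotone fun n => (σ n).1.1 := monotone_nat_of_le_succ fun n => hle (σ n)
  have htmem : ∀ m n, m < n → t m ∈ (σ n).1.2 := fun m n hmn => by
    refine hVmono hmn ?_
    simp only [Nat.succ_eq_add_one, hVs m]
    exact Submodule.mem_sup_right (Submodule.mem_span_singleton_self _)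
  have hsum : ∀ n, ∑ m ∈ Finset.range n, t m ∈ (σ n).1.2 := fun n =>
    Submodule.sum_mem _ fun m hm => htmem m n (by simpa using hm)
  have htπ : ∀ n m, n ≤ m → π (σ n).1.1 (t m) = 0 := fun n m hnm =>
    hmono (himono hnm) _ (hTπ (σ m))
  obtain ⟨Λ, hΛ⟩ := exists_summation_functional k
  -- `a` plays the role of Σ t_m: every continuous functional sees only finitely many nonzero terms.
  obtain ⟨a, ha⟩ := hcompl (Λ ∘ₗ LinearMap.pi fun m => Module.Dual.eval k A (t m))
  have ha' : ∀ i (c : Module.Dual k (F i)), Λ (fun m => c (π i (t m))) = c (π i a) := ha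
  let L : Submodule A A := Submodule.span A (Set.range t)
  have haL : a ∈ L := by
    obtain ⟨s, hs⟩ := hann L
    rw [hs]
    intro x hx
    apply hsep
    intro i
    -- `a` lies in the closure of `L`: a functional vanishing on π_i(L) kills every term, hence
    -- π_i(a). Annihilators are closed, so a ∈ L.
    have hi : π i a ∈ (L.restrictScalars k).map (π i).toLinearMap := by
      by_contra hi
      obtain ⟨c, hc, hcL⟩ := Submodule.exists_le_ker_of_notMem hi
      apply hc
      rw [← ha' i c]
      have : (fun m => c (π i (t m))) = 0 := by
        ext m
        exact hcL (Submodule.mem_map_of_mem (f := (π i).toLinearMap)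
          (Submodule.subset_span ⟨m, rfl⟩ : t m ∈ L))
      rw [this, map_zero]
    obtain ⟨y, hy, hya⟩ := hi
    have hya' : π i y = π i a := hya
    rw [map_mul, ← hya', ← map_mul, (hs y).mp hy x hx, map_zero]
  have hLV : ∀ x ∈ L, ∃ n, x ∈ (σ n).1.2 := by
    intro x hx
    have hL : L ≤ ⨆ n, (σ n).1.2 := by
      refine Submodule.span_le.mpr ?_
      rintro _ ⟨m, rfl⟩
      exact le_iSup (fun n => (σ n).1.2) (m + 1) (htmem m (m + 1) m.lt_succ_self)
    exact (Submodule.mem_iSup_of_directed _ hVmono.directed_le).mp (hL hx)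
  obtain ⟨N, hN⟩ := hLV a haL
  -- All t_m with m > N die under the projection of stage N + 1, which is injective on the ideal
  -- containing both sides.
  have haN : a = ∑ m ∈ Finset.range (N + 1), t m := by
    rw [← sub_eq_zero]
    refine (σ (N + 1)).2.2 _ (Submodule.sub_mem _ (hVmono N.le_succ hN) (hsum (N + 1))) ?_
    rw [← Module.forall_dual_apply_eq_zero_iff k]
    intro c
    rw [map_sub, map_sub, ← ha' _ c, hΛ _ (N + 1) fun m hm => by rw [htπ _ _ hm, map_zero],
      map_sum, map_sum, sub_self]
  have htN : t N ∈ (σ N).1.2 := by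
    rw [Finset.sum_range_succ] at haN
    rw [show t N = a - ∑ m ∈ Finset.range N, t m by rw [haN]; abel]
    exact Submodule.sub_mem _ hN (hsum N)
  exact hT0 (σ N) ((σ N).2.2 _ htN (htπ N N le_rfl))

end Projections

theorem IsProfiniteAlgebra.finiteDimensional {k : Type v} {A : Type u} [Field k] [Ring A]
    [Algebra k A] (hA : IsProfiniteAlgebra k A) (hann : LeftIdealsAreAnnihilators A) :
    FiniteDimensional k A := by
  obtain ⟨ι, _, _, _, F, _, _, π, hF, hmono, hsep, hcompl⟩ := hA.exists_projections
  obtain ⟨i, hi⟩ := exists_projection_no_finiteDimensional_ideal π hmono hsep hcompl hann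
  refine FiniteDimensional.of_injective (π i).toLinearMap
    ((injective_iff_map_eq_zero _).mpr fun a ha => hsep a fun j => ?_)
  obtain ⟨s, hs⟩ := hann (RingHom.ker (π j).toRingHom)
  refine (hs a).mpr fun x hx => hi _ ?_ ?_
  · have ha' : π i a = 0 := ha
    rw [map_mul, ha', zero_mul]
  · have hrange : FiniteDimensional k (LinearMap.range (LinearMap.mulRight k x)) :=
      finiteDimensional_range_of_ker_le (π j).toLinearMap _ fun b hb => (hs b).mp hb x hx
    refine FiniteDimensional.of_injective (Submodule.inclusion (p := ((Submodule.span A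
      {a * x}).restrictScalars k)) (p' := LinearMap.range (LinearMap.mulRight k x)) ?_)
      (Submodule.inclusion_injective _)
    intro y hy
    obtain ⟨b, rfl⟩ := Submodule.mem_span_singleton.mp hy
    exact ⟨b * a, by simp [mul_assoc]⟩

/-! ### Uniform projective modules of finite length -/

section Uniform

variable {R : Type*} [Ring R] {X : Type*} [AddCommGroup X] [Module R X]

theorem Module.Projective.isCoatom_unique [Module.Projective R X] [IsArtinian R X]
    [IsNoetherian R X] (hX : ∀ N N' : Submodule R X, Disjoint N N' → N = ⊥ ∨ N' = ⊥)
    {M N : Submodule R X} (hM : IsCoatom M) (hN : IsCoatom N) : M = N := by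
  by_contra hne
  have hsup : M ⊔ N = ⊤ := (hM.codisjoint_of_ne hN hne).eq_top
  have hsurj : Function.Surjective (N.mkQ ∘ₗ M.subtype) := by
    rw [← LinearMap.range_eq_top, LinearMap.range_comp, Submodule.range_subtype,
      Submodule.map_mkQ_eq_top, sup_comm, hsup]
  obtain ⟨h, hh⟩ := Module.projective_lifting_property _ N.mkQ hsurj
  -- `g` has image in M and is the identity modulo N. By Fitting's lemma and uniformity some
  -- positive power is surjective or zero; the first contradicts M ≠ ⊤, the second N ≠ ⊤.
  let g : Module.End R X := M.subtype ∘ₗ h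
  have hg : N.mkQ ∘ₗ g = N.mkQ := by rw [← LinearMap.comp_assoc, hh]
  have hgn : ∀ n, N.mkQ ∘ₗ (g ^ n) = N.mkQ := fun n => by
    induction n with
    | zero => rfl
    | succ n ih => rw [pow_succ, Module.End.mul_eq_comp, ← LinearMap.comp_assoc, ih, hg]
  obtain ⟨n, hn⟩ := (Filter.eventually_atTop.mp g.eventually_isCompl_ker_pow_range_pow)
  have hc := hn (n + 1) n.le_succ
  rcases hX _ _ hc.disjoint with h0 | h0
  · have htop : LinearMap.range (g ^ (n + 1)) = ⊤ := by simpa [h0] using hc.codisjoint.eq_top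
    apply hM.1
    rw [eq_top_iff, ← htop, pow_succ', Module.End.mul_eq_comp]
    rintro _ ⟨x, rfl⟩
    exact (h _).2
  · rw [LinearMap.range_eq_bot] at h0
    apply hN.1
    rw [← Submodule.ker_mkQ N, ← hgn (n + 1), h0, LinearMap.comp_zero, LinearMap.ker_zero]

theorem Module.Projective.nonempty_equiv_of_simple_quotient {Y T : Type*} [AddCommGroup Y]
    [Module R Y] [AddCommGroup T] [Module R T] [IsSimpleModule R T]
    [Module.Projective R X] [Module.Projective R Y] [IsArtinian R Y] [IsNoetherian R Y]
    (hX : ∀ N N' : Submodule R X, Disjoint N N' → N = ⊥ ∨ N' = ⊥)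
    (hY : ∀ N N' : Submodule R Y, Disjoint N N' → N = ⊥ ∨ N' = ⊥)
    (f : X →ₗ[R] T) (hf : Function.Surjective f) (g : Y →ₗ[R] T) (hg : Function.Surjective g) :
    Nonempty (X ≃ₗ[R] Y) := by
  obtain ⟨φ, hφ⟩ := Module.projective_lifting_property g f hg
  have hker : IsCoatom (LinearMap.ker g) := by
    rw [← isSimpleModule_iff_isCoatom]
    exact IsSimpleModule.congr (g.quotKerEquivOfSurjective hg)
  have hT := IsSimpleModule.nontrivial R T
  have hsurj : Function.Surjective φ := by
    rw [← LinearMap.range_eq_top]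
    -- A proper image would lie in the unique maximal submodule ker g, making f = g ∘ φ zero.
    refine (eq_top_or_exists_le_coatom (LinearMap.range φ)).resolve_right ?_
    rintro ⟨m, hm, hle⟩
    rw [Module.Projective.isCoatom_unique hY hm hker] at hle
    obtain ⟨t, ht⟩ := exists_ne (0 : T)
    obtain ⟨x, rfl⟩ := hf t
    exact ht (by rw [← hφ]; exact hle ⟨x, rfl⟩)
  obtain ⟨s, hs⟩ := Module.projective_lifting_property φ LinearMap.id hsurj
  have hs' : ∀ y, φ (s y) = y := LinearMap.congr_fun hs
  have hdisj : Disjoint (LinearMap.ker φ) (LinearMap.range s) := by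
    rw [Submodule.disjoint_def]
    rintro _ hx ⟨y, rfl⟩
    rw [LinearMap.mem_ker, hs'] at hx
    rw [hx, map_zero]
  refine ⟨LinearEquiv.ofBijective φ ⟨LinearMap.ker_eq_bot.mp ((hX _ _ hdisj).resolve_right ?_),
    hsurj⟩⟩
  intro h0
  rw [LinearMap.range_eq_bot] at h0
  obtain ⟨t, ht⟩ := exists_ne (0 : T)
  obtain ⟨y, rfl⟩ := hg t
  exact ht (by rw [← hs' y, h0]; simp)

end Uniform

/-! ### Simple modules and summands with simple socle -/

section Annihilators

variable {A : Type u} [Ring A]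

/-- For T ≅ A/m and nonzero x annihilated by m, right multiplication by x embeds A/m in A. -/
theorem LeftIdealsAreAnnihilators.exists_injective (hann : LeftIdealsAreAnnihilators A)
    (T : Type*) [AddCommGroup T] [Module A T] [IsSimpleModule A T] :
    ∃ g : T →ₗ[A] A, Function.Injective g := by
  obtain ⟨m, hm, ⟨e⟩⟩ := isSimpleModule_iff_quot_maximal.mp ‹IsSimpleModule A T›
  obtain ⟨s, hs⟩ := hann m
  have hx : ∃ x ∈ s, x ≠ 0 := by
    by_contra! h
    exact hm.ne_top ((Ideal.eq_top_iff_one m).mpr ((hs 1).mpr fun x hx => by simp [h x hx]))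
  obtain ⟨x, hxs, hx⟩ := hx
  have hle : m ≤ LinearMap.ker (LinearMap.toSpanSingleton A A x) := fun a ha =>
    (hs a).mp ha x hxs
  have := IsSimpleModule.congr e.symm
  have h0 : m.liftQ _ hle ≠ 0 := fun h => hx <| by
    simpa using LinearMap.congr_fun h (m.mkQ 1)
  exact ⟨m.liftQ _ hle ∘ₗ e.toLinearMap, (LinearMap.injective_of_ne_zero h0).comp e.injective⟩

theorem LeftIdealsAreAnnihilators.isotypicComponent_mem (hann : LeftIdealsAreAnnihilators A)
    (T : Type*) [AddCommGroup T] [Module A T] [IsSimpleModule A T] :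
    isotypicComponent A A T ∈ isotypicComponents A A := by
  obtain ⟨g, hg⟩ := hann.exists_injective T
  let e := LinearEquiv.ofInjective g hg
  exact ⟨LinearMap.range g, IsSimpleModule.congr e.symm, e.isotypicComponent_eq⟩

theorem LeftIdealsAreAnnihilators.nonempty_equiv_of_isotypicComponent_eq
    (hann : LeftIdealsAreAnnihilators A)
    (T T' : Type*) [AddCommGroup T] [Module A T] [IsSimpleModule A T] [AddCommGroup T']
    [Module A T'] [IsSimpleModule A T']
    (h : isotypicComponent A A T = isotypicComponent A A T') : Nonempty (T ≃ₗ[A] T') := by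
  obtain ⟨g, hg⟩ := hann.exists_injective T
  let e := LinearEquiv.ofInjective g hg
  have := IsSimpleModule.congr e.symm
  obtain ⟨e'⟩ := isIsotypicOfType_submodule_iff.mp
    (IsIsotypicOfType.isotypicComponent A A T') (LinearMap.range g)
    ((Submodule.le_isotypicComponent _).trans (by rw [← h, e.isotypicComponent_eq]))
  exact ⟨e.trans e'⟩

end Annihilators

theorem finiteDimensional_submodule (k : Type*) {A : Type*} [Field k] [Ring A] [Algebra k A] {M : Type*} [AddCommGroup M] [Module k M] [Module A M]
    [IsScalarTower k A M] [FiniteDimensional k M] (S : Submodule A M) : FiniteDimensional k S :=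
  inferInstanceAs (FiniteDimensional k (S.restrictScalars k))

/-- Take K maximal with S ∩ K = 0. The annihilator condition gives x with K = ker(· x), so Ax ≅ A/K
has essential simple submodule Sx ≅ S. Either dim X = dim A/K and X ⊕ K = A, or Ax is larger than X
and the argument repeats with it. -/
theorem LeftIdealsAreAnnihilators.exists_isCompl_essential_simple
    (k : Type v) {A : Type u} [Field k] [Ring A] [Algebra k A] [FiniteDimensional k A]
    (hann : LeftIdealsAreAnnihilators A) (X S : Submodule A A) [IsSimpleModule A S] (hSX : S ≤ X)
    (hess : ∀ N ≤ X, N ≠ ⊥ → S ≤ N) :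
    ∃ X' K S' : Submodule A A, IsCompl X' K ∧ S' ≤ X' ∧ Nonempty (S' ≃ₗ[A] S) ∧
      ∀ N ≤ X', N ≠ ⊥ → S' ≤ N := by
  induction h : Module.finrank k A - Module.finrank k X using
    Nat.strong_induction_on generalizing X S with
  | _ n ih =>
    have hNoeth : IsNoetherian A A := isNoetherian_of_tower k inferInstance
    have hS : IsAtom S := isSimpleModule_iff_isAtom.mp inferInstance
    obtain ⟨K, hK, hKmax⟩ := set_has_maximal_iff_noetherian.mpr hNoeth
      {K : Submodule A A | Disjoint S K} ⟨⊥, disjoint_bot_right⟩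
    have hKX : Disjoint X K := by
      rw [disjoint_iff]
      by_contra hne
      exact hS.1 (eq_bot_iff.mpr ((le_inf le_rfl (hess _ inf_le_left hne)).trans
        (le_trans (inf_le_inf_left S inf_le_right) hK.le_bot)))
    obtain ⟨s, hs⟩ := hann K
    have hx : ∃ x ∈ s, ∃ y ∈ S, y * x ≠ 0 := by
      by_contra! hc
      exact hS.1 (eq_bot_iff.mpr ((le_inf le_rfl fun y hy => (hs y).mpr fun x hx =>
        hc x hx y hy).trans hK.le_bot))
    obtain ⟨x, hxs, y, hyS, hyx⟩ := hx
    let ρ := LinearMap.toSpanSingleton A A x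
    have hKρ : K ≤ LinearMap.ker ρ := fun a ha => (hs a).mp ha x hxs
    have hSρ : Disjoint S (LinearMap.ker ρ) :=
      hS.not_le_iff_disjoint.mp fun hle => hyx (hle hyS)
    have hker : LinearMap.ker ρ = K := by
      by_contra hne
      exact hKmax _ hSρ (lt_of_le_of_ne hKρ (Ne.symm hne))
    have hinj : Function.Injective (ρ.domRestrict S) := by
      rw [← LinearMap.ker_eq_bot, LinearMap.ker_domRestrict, ← Submodule.disjoint_iff_comap_eq_bot]
      exact hSρ
    let e := LinearEquiv.ofInjective _ hinj
    have hsimple := IsSimpleModule.congr e.symm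
    have hdim : Module.finrank k (LinearMap.range ρ) + Module.finrank k K = Module.finrank k A := by
      rw [← hker]
      exact (ρ.restrictScalars k).finrank_range_add_finrank_ker
    have hdimX : Module.finrank k X + Module.finrank k K ≤ Module.finrank k A :=
      Submodule.finrank_add_finrank_le_of_disjoint (s := X.restrictScalars k)
        (t := K.restrictScalars k)
        (Submodule.disjoint_def.mpr fun a ha hb => Submodule.disjoint_def.mp hKX a ha hb)
    by_cases heq : Module.finrank k X + Module.finrank k K = Module.finrank k A
    · refine ⟨X, K, S, ⟨hKX, ?_⟩, hSX, ⟨.refl _ _⟩, hess⟩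
      have htop := Submodule.eq_top_of_disjoint (X.restrictScalars k) (K.restrictScalars k)
        heq.ge (Submodule.disjoint_def.mpr fun a ha hb => Submodule.disjoint_def.mp hKX a ha hb)
      rw [← Submodule.restrictScalars_sup, Submodule.restrictScalars_eq_top_iff] at htop
      exact codisjoint_iff.mpr htop
    · obtain ⟨X', K', S', hc, hS', ⟨e'⟩, hess'⟩ := ih
        (Module.finrank k A - Module.finrank k (LinearMap.range ρ)) (by omega)
        (LinearMap.range ρ) (LinearMap.range (ρ.domRestrict S))
        (by rw [LinearMap.range_domRestrict]; exact LinearMap.map_le_range)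
        (fun N hN hN0 => by
          rw [LinearMap.range_domRestrict, Submodule.map_le_iff_le_comap]
          by_contra hle
          have hd : Disjoint S (N.comap ρ) := hS.not_le_iff_disjoint.mp hle
          have hle' : LinearMap.ker ρ ≤ N.comap ρ := LinearMap.ker_le_comap ρ
          have hEq : N.comap ρ = LinearMap.ker ρ := by
            by_contra hne
            exact hKmax _ hd (hker ▸ lt_of_le_of_ne hle' (Ne.symm hne))
          apply hN0
          rw [← Submodule.map_comap_eq_self hN, hEq, ← le_bot_iff, Submodule.map_le_iff_le_comap]
          rfl) rfl
      exact ⟨X', K', S', hc, hS', ⟨e'.trans e.symm⟩, hess'⟩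

/-! ### Dimensions of Hom spaces and the extension of maps -/

section Hom

variable (k : Type*) {A : Type*} [Field k] [Ring A] [Algebra k A]
  {M X : Type*} [AddCommGroup M] [Module k M] [Module A M] [IsScalarTower k A M]
  [FiniteDimensional k M] [AddCommGroup X] [Module k X] [Module A X] [IsScalarTower k A X]
  [FiniteDimensional k X]

theorem finrank_hom_eq_quotient_add_range (N : Submodule A M) :
    Module.finrank k (M →ₗ[A] X) = Module.finrank k ((M ⧸ N) →ₗ[A] X) +
      Module.finrank k (LinearMap.range (LinearMap.lcomp k X N.subtype)) := by
  rw [← (LinearMap.lcomp k X N.subtype).finrank_range_add_finrank_ker, add_comm]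
  congr 1
  have hinj : Function.Injective (LinearMap.lcomp k X N.mkQ) := fun f g hfg =>
    Submodule.linearMap_qext _ hfg
  have hker : LinearMap.ker (LinearMap.lcomp k X N.subtype) =
      LinearMap.range (LinearMap.lcomp k X N.mkQ) := by
    ext f
    constructor
    · intro hf
      refine ⟨N.liftQ f fun x hx => LinearMap.congr_fun hf ⟨x, hx⟩, ?_⟩
      ext x
      rfl
    · rintro ⟨g, rfl⟩
      ext ⟨x, hx⟩
      simp [(Submodule.Quotient.mk_eq_zero N).mpr hx]
  rw [← LinearMap.finrank_range_of_inj hinj, hker]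

theorem finrank_hom_of_projective [Module.Projective A X] (N : Submodule A M) :
    Module.finrank k (X →ₗ[A] M) = Module.finrank k (X →ₗ[A] N) +
      Module.finrank k (X →ₗ[A] (M ⧸ N)) := by
  rw [← (LinearMap.compRight k (M := X) N.mkQ).finrank_range_add_finrank_ker, add_comm]
  have hsurj : LinearMap.range (LinearMap.compRight k (M := X) N.mkQ) = ⊤ :=
    LinearMap.range_eq_top.mpr fun f =>
      Module.projective_lifting_property N.mkQ f N.mkQ_surjective
  have hinj : Function.Injective (LinearMap.compRight k (M := X) N.subtype) := fun f g hfg => by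
    ext x
    exact LinearMap.congr_fun hfg x
  have hker : LinearMap.ker (LinearMap.compRight k (M := X) N.mkQ) =
      LinearMap.range (LinearMap.compRight k (M := X) N.subtype) := by
    ext f
    constructor
    · intro hf
      have hf' : ∀ x, f x ∈ N := fun x =>
        (Submodule.Quotient.mk_eq_zero N).mp (LinearMap.congr_fun hf x)
      exact ⟨f.codRestrict N hf', rfl⟩
    · rintro ⟨g, rfl⟩
      ext x
      simp
  rw [hsurj, finrank_top, ← LinearMap.finrank_range_of_inj hinj, hker]

end Hom

section Dimension

variable {k : Type v} {A : Type u} [Field k] [Ring A] [Algebra k A]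
  {X : Type u} [AddCommGroup X] [Module k X] [Module A X] [IsScalarTower k A X]
  [FiniteDimensional k X] [Module.Projective A X]

theorem finrank_hom_le_of_simple
    (hdim : ∀ (T : Type u) [AddCommGroup T] [Module k T] [Module A T] [IsScalarTower k A T]
      [FiniteDimensional k T] [IsSimpleModule A T],
      Module.finrank k (T →ₗ[A] X) ≤ Module.finrank k (X →ₗ[A] T))
    (M : Type u) [AddCommGroup M] [Module k M] [Module A M] [IsScalarTower k A M]
    [FiniteDimensional k M] :
    Module.finrank k (M →ₗ[A] X) ≤ Module.finrank k (X →ₗ[A] M) := by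
  induction h : Module.finrank k M using Nat.strong_induction_on generalizing M with
  | _ n ih =>
    cases subsingleton_or_nontrivial M with
    | inl hM =>
      have : Subsingleton (M →ₗ[A] X) :=
        ⟨fun f g => by ext x; rw [Subsingleton.elim x 0, map_zero, map_zero]⟩
      rw [Module.finrank_zero_of_subsingleton]
      exact Nat.zero_le _
    | inr hM =>
      have : IsArtinian A M := isArtinian_of_tower k inferInstance
      obtain ⟨N, hN, -⟩ := (eq_bot_or_exists_atom_le (⊤ : Submodule A M)).resolve_left top_ne_bot
      have := isSimpleModule_iff_isAtom.mpr hN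
      have := finiteDimensional_submodule k N
      have hlt : Module.finrank k (M ⧸ N) < n := by
        rw [← h, ← Submodule.finrank_quotient_add_finrank (N.restrictScalars k)]
        refine Nat.lt_add_of_pos_right ?_
        have := IsSimpleModule.nontrivial A N
        exact Module.finrank_pos (R := k) (M := N)
      have h1 := ih _ hlt (M ⧸ N) rfl
      have h2 := finrank_hom_eq_quotient_add_range k (X := X) N
      have h3 := Submodule.finrank_le (LinearMap.range (LinearMap.lcomp k X N.subtype))
      have h4 := finrank_hom_of_projective k (X := X) N
      have h5 := hdim N
      omega

/-- Comparing 0 → N → Y → Y/N under Hom(-,X), left exact, and Hom(X,-), exact, leaves no room for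
restriction to N to miss a map. -/
theorem exists_extension_of_finrank_hom_le
    (hdim : ∀ (M : Type u) [AddCommGroup M] [Module k M] [Module A M] [IsScalarTower k A M]
      [FiniteDimensional k M],
      Module.finrank k (M →ₗ[A] X) ≤ Module.finrank k (X →ₗ[A] M))
    (Y : Type u) [AddCommGroup Y] [Module k Y] [Module A Y] [IsScalarTower k A Y]
    [FiniteDimensional k Y]
    (hY : Module.finrank k (X →ₗ[A] Y) ≤ Module.finrank k (Y →ₗ[A] X))
    (N : Submodule A Y) (f : N →ₗ[A] X) : ∃ g : Y →ₗ[A] X, ∀ x : N, g x = f x := by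
  have := finiteDimensional_submodule k N
  have h1 := finrank_hom_eq_quotient_add_range k (X := X) N
  have h2 := finrank_hom_of_projective k (X := X) N
  have h3 := hdim (Y ⧸ N)
  have h4 := hdim N
  have htop : LinearMap.range (LinearMap.lcomp k X N.subtype) = ⊤ :=
    Submodule.eq_top_of_finrank_eq
      (le_antisymm (Submodule.finrank_le _) (by omega))
  obtain ⟨g, hg⟩ := LinearMap.range_eq_top.mp htop f
  exact ⟨g, fun x => LinearMap.congr_fun hg x⟩

theorem finrank_hom_pi_const (k : Type*) {A : Type*} [Field k] [Ring A] [Algebra k A]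
    (X : Type*) [AddCommGroup X] [Module k X] [Module A X] [IsScalarTower k A X]
    (J : Type*) [Fintype J] :
    Module.finrank k (X →ₗ[A] (J → X)) = Module.finrank k ((J → X) →ₗ[A] X) := by
  classical
  rw [← (LinearMap.lsum A (fun _ : J => X) k (M := X)).finrank_eq]
  let e : (X →ₗ[A] (J → X)) ≃ₗ[k] (J → X →ₗ[A] X) :=
    { toFun := fun f j => LinearMap.proj j ∘ₗ f
      invFun := fun f => LinearMap.pi f
      map_add' := fun _ _ => rfl
      map_smul' := fun _ _ => rfl
      left_inv := fun _ => rfl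
      right_inv := fun _ => rfl }
  exact e.finrank_eq

/-- The range of g contains the image of every map X → A. Were it inside a maximal left ideal m, a
surjection X → A/m, lifted to A, would be zero. -/
theorem exists_surjective_pi_of_simple_quotients [FiniteDimensional k A]
    (hgen : ∀ (T : Type u) [AddCommGroup T] [Module A T] [IsSimpleModule A T],
      ∃ f : X →ₗ[A] T, Function.Surjective f) :
    ∃ (n : ℕ) (g : (ULift.{u} (Fin n) → X) →ₗ[A] A), Function.Surjective g := by
  let b := Module.finBasis k (X →ₗ[A] A)
  let g : (ULift.{u} (Fin (Module.finrank k (X →ₗ[A] A))) → X) →ₗ[A] A :=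
    ∑ j, b j.down ∘ₗ LinearMap.proj j
  refine ⟨_, g, ?_⟩
  have hmem : ∀ (f : X →ₗ[A] A) (x : X), f x ∈ LinearMap.range g := fun f x => by
    refine ⟨fun j => b.repr f j.down • x, ?_⟩
    conv_rhs => rw [← b.sum_repr f]
    simp only [g, LinearMap.sum_apply, LinearMap.comp_apply, LinearMap.proj_apply,
      LinearMap.smul_apply, LinearMap.map_smul_of_tower]
    exact Fintype.sum_equiv Equiv.ulift _ _ fun _ => rfl
  rw [← LinearMap.range_eq_top]
  have : IsNoetherian A A := isNoetherian_of_tower k inferInstance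
  refine (eq_top_or_exists_le_coatom (LinearMap.range g)).resolve_right ?_
  rintro ⟨m, hm, hle⟩
  have hsimple := isSimpleModule_iff_isCoatom.mpr hm
  obtain ⟨f, hf⟩ := hgen (A ⧸ m)
  obtain ⟨h, hh⟩ := Module.projective_lifting_property m.mkQ f m.mkQ_surjective
  have := IsSimpleModule.nontrivial A (A ⧸ m)
  obtain ⟨t, ht⟩ := exists_ne (0 : A ⧸ m)
  obtain ⟨x, rfl⟩ := hf t
  apply ht
  rw [← hh]
  exact (Submodule.Quotient.mk_eq_zero m).mpr (hle (hmem h x))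

theorem injective_self_of_finrank_hom_le [FiniteDimensional k A]
    (hgen : ∀ (T : Type u) [AddCommGroup T] [Module A T] [IsSimpleModule A T],
      ∃ f : X →ₗ[A] T, Function.Surjective f)
    (hdim : ∀ (T : Type u) [AddCommGroup T] [Module k T] [Module A T] [IsScalarTower k A T]
      [FiniteDimensional k T] [IsSimpleModule A T],
      Module.finrank k (T →ₗ[A] X) ≤ Module.finrank k (X →ₗ[A] T)) :
    Module.Injective A A := by
  obtain ⟨n, p, hp⟩ := exists_surjective_pi_of_simple_quotients (k := k) hgen
  obtain ⟨s, hs⟩ := Module.projective_lifting_property p LinearMap.id hp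
  have hs' : ∀ y, p (s y) = y := LinearMap.congr_fun hs
  have hsinj : Function.Injective s := Function.LeftInverse.injective hs'
  refine Module.Baer.injective fun I f => ?_
  let e := Submodule.equivMapOfInjective s hsinj I
  have hext := exists_extension_of_finrank_hom_le (k := k) (A := A) (X := X)
    (fun M => finrank_hom_le_of_simple hdim M) (ULift.{u} (Fin n) → X)
    (finrank_hom_pi_const k X _).le (Submodule.map s I)
  choose g hg using fun j => hext (LinearMap.proj j ∘ₗ s ∘ₗ f ∘ₗ e.symm.toLinearMap)
  refine ⟨p ∘ₗ LinearMap.pi g ∘ₗ s, fun x hx => ?_⟩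
  have hx' : LinearMap.pi g (s x) = s (f ⟨x, hx⟩) := by
    ext j
    have h1 := hg j (e ⟨x, hx⟩)
    simpa [e] using h1
  rw [LinearMap.comp_apply, LinearMap.comp_apply, hx', hs']

end Dimension

/-! ### Matching socles with tops, and self-injectivity -/

theorem LeftIdealsAreAnnihilators.exists_projective_family
    (k : Type v) {A : Type u} [Field k] [Ring A] [Algebra k A] [FiniteDimensional k A]
    (hann : LeftIdealsAreAnnihilators A) :
    ∃ X S : isotypicComponents A A → Submodule A A,
      (∀ c, Module.Projective A (X c)) ∧ (∀ c, S c ≤ X c) ∧ (∀ c, IsSimpleModule A (S c)) ∧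
      (∀ c, isotypicComponent A A (S c) = c) ∧ (∀ c, ∀ N ≤ X c, N ≠ ⊥ → S c ≤ N) ∧
      ∀ (T : Type u) [AddCommGroup T] [Module A T] [IsSimpleModule A T],
        ∃ c, ∃ f : X c →ₗ[A] T, Function.Surjective f := by
  have hNoeth : IsNoetherian A A := isNoetherian_of_tower k inferInstance
  have hArt : IsArtinian A A := isArtinian_of_tower k inferInstance
  have hX : ∀ c : isotypicComponents A A, ∃ X S : Submodule A A, Module.Projective A X ∧ S ≤ X ∧
      IsSimpleModule A S ∧ isotypicComponent A A S = c ∧ ∀ N ≤ X, N ≠ ⊥ → S ≤ N := by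
    rintro ⟨_, S, hS, rfl⟩
    obtain ⟨X, K, S', hc, hle, ⟨e⟩, hess⟩ := hann.exists_isCompl_essential_simple k S S le_rfl
      fun N hN hN0 => ((isSimpleModule_iff_isAtom.mp hS).le_iff_eq hN0).mp hN |>.ge
    refine ⟨X, S', ?_, hle, IsSimpleModule.congr e, e.isotypicComponent_eq, hess⟩
    exact Module.Projective.of_split X.subtype (Submodule.projectionOnto X K hc) (by ext; simp)
  choose X S hproj hle hsimple hcomp hess using hX
  have huniform : ∀ c, ∀ N N' : Submodule A (X c), Disjoint N N' → N = ⊥ ∨ N' = ⊥ := by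
    intro c N N' hd
    by_contra! hne
    have h1 : ∀ L : Submodule A (X c), L ≠ ⊥ → (S c).comap (X c).subtype ≤ L := by
      intro L hL
      have := hess c (L.map (X c).subtype) (Submodule.map_subtype_le _ _) (by
        rwa [Ne, ← Submodule.map_bot (X c).subtype,
          (Submodule.map_injective_of_injective (X c).subtype_injective).eq_iff])
      rw [← Submodule.comap_map_eq_of_injective (X c).subtype_injective L]
      exact Submodule.comap_mono this
    have hbot := eq_bot_iff.mpr ((le_inf (h1 N hne.1) (h1 N' hne.2)).trans hd.le_bot)
    refine (isSimpleModule_iff_isAtom.mp (hsimple c)).1 ?_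
    have hmap : ((S c).comap (X c).subtype).map (X c).subtype = S c :=
      Submodule.map_comap_eq_self (by rw [Submodule.range_subtype]; exact hle c)
    rw [← hmap, hbot, Submodule.map_bot]
  have hmax : ∀ c, ∃ M : Submodule A (X c), IsCoatom M := by
    intro c
    have hne : (⊤ : Submodule A (X c)) ≠ ⊥ := fun h => by
      have h0 : X c = ⊥ := (Submodule.subsingleton_iff_eq_bot).mp
        ((Submodule.subsingleton_iff A).mp (subsingleton_of_bot_eq_top h.symm))
      exact (isSimpleModule_iff_isAtom.mp (hsimple c)).1 (eq_bot_iff.mpr (h0 ▸ hle c))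
    obtain ⟨M, hM, -⟩ := (eq_top_or_exists_le_coatom (⊥ : Submodule A (X c))).resolve_left hne.symm
    exact ⟨M, hM⟩
  choose M hM using hmax
  have hMsimple := fun c => isSimpleModule_iff_isCoatom.mpr (hM c)
  -- `τ` sends the socle type of X_c to the type of its simple quotient. Equal quotients give
  -- isomorphic X_c, hence equal socles; finiteness makes τ surjective.
  let τ : isotypicComponents A A → isotypicComponents A A := fun c =>
    ⟨isotypicComponent A A (X c ⧸ M c), hann.isotypicComponent_mem _⟩
  have hτ : Function.Injective τ := by
    intro c d hcd
    obtain ⟨e⟩ := hann.nonempty_equiv_of_isotypicComponent_eq _ _ (congrArg Subtype.val hcd)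
    obtain ⟨e'⟩ := Module.Projective.nonempty_equiv_of_simple_quotient (huniform c) (huniform d)
      (e.toLinearMap ∘ₗ (M c).mkQ) (e.surjective.comp (M c).mkQ_surjective) (M d).mkQ
      (M d).mkQ_surjective
    let g : S c →ₗ[A] A := (X d).subtype ∘ₗ e'.toLinearMap ∘ₗ Submodule.inclusion (hle c)
    have hg : Function.Injective g := (X d).subtype_injective.comp
      (e'.injective.comp (Submodule.inclusion_injective _))
    let e'' := LinearEquiv.ofInjective g hg
    have hrange : IsSimpleModule A (LinearMap.range g) := IsSimpleModule.congr e''.symm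
    have hatom := isSimpleModule_iff_isAtom.mp hrange
    have hSd : S d ≤ LinearMap.range g := hess d _ (by
      rintro _ ⟨x, rfl⟩
      exact Subtype.property _) hatom.1
    have hEq := (hatom.le_iff_eq (isSimpleModule_iff_isAtom.mp (hsimple d)).1).mp hSd
    apply Subtype.ext
    rw [← hcomp c, ← hcomp d, hEq]
    exact e''.isotypicComponent_eq
  refine ⟨X, S, hproj, hle, hsimple, hcomp, hess, fun T _ _ _ => ?_⟩
  obtain ⟨c, hc⟩ := Finite.injective_iff_surjective.mp hτ
    ⟨isotypicComponent A A T, hann.isotypicComponent_mem T⟩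
  obtain ⟨e⟩ := hann.nonempty_equiv_of_isotypicComponent_eq _ _ (congrArg Subtype.val hc)
  exact ⟨c, e.toLinearMap ∘ₗ (M c).mkQ, e.surjective.comp (M c).mkQ_surjective⟩

theorem LeftIdealsAreAnnihilators.injective_self
    (k : Type v) {A : Type u} [Field k] [Ring A] [Algebra k A] [FiniteDimensional k A]
    (hann : LeftIdealsAreAnnihilators A) : Module.Injective A A := by
  classical
  obtain ⟨X, S, hproj, hle, hsimple, hcomp, hess, hgen⟩ := hann.exists_projective_family k
  have hNoeth : IsNoetherian A A := isNoetherian_of_tower k inferInstance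
  let _ : Fintype (isotypicComponents A A) := Fintype.ofFinite _
  have hfin := fun c => finiteDimensional_submodule k (X c)
  have hgen' : ∀ (T : Type u) [AddCommGroup T] [Module A T] [IsSimpleModule A T],
      ∃ f : (∀ c, X c) →ₗ[A] T, Function.Surjective f := by
    intro T _ _ _
    obtain ⟨c, f, hf⟩ := hgen T
    exact ⟨f ∘ₗ LinearMap.proj c, hf.comp (LinearMap.proj_surjective c)⟩
  have : Module.Projective A (∀ c, X c) :=
    Module.Projective.of_equiv DFinsupp.linearEquivFunOnFintype
  refine injective_self_of_finrank_hom_le (k := k) (X := ∀ c, X c) hgen' ?_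
  intro T _ _ _ _ _ _
  obtain ⟨q, hq⟩ := hgen' T
  have h1 : Module.finrank k (T →ₗ[A] T) ≤ Module.finrank k ((∀ c, X c) →ₗ[A] T) :=
    LinearMap.finrank_le_finrank_of_injective (f := LinearMap.lcomp k T q) fun f g hfg =>
      LinearMap.cancel_right hq |>.mp hfg
  refine le_trans ?_ h1
  let c₀ : isotypicComponents A A := ⟨isotypicComponent A A T, hann.isotypicComponent_mem T⟩
  have hrange : ∀ (f : T →ₗ[A] ∀ c, X c) (c) , LinearMap.proj c ∘ₗ f ≠ 0 →
      LinearMap.range ((X c).subtype ∘ₗ LinearMap.proj c ∘ₗ f) = S c ∧ c = c₀ := by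
    intro f c hf
    have hinj : Function.Injective ((X c).subtype ∘ₗ LinearMap.proj c ∘ₗ f) :=
      (X c).subtype_injective.comp (LinearMap.injective_of_ne_zero hf)
    let e := LinearEquiv.ofInjective _ hinj
    have hatom := isSimpleModule_iff_isAtom.mp (IsSimpleModule.congr e.symm)
    have hSc : S c ≤ LinearMap.range ((X c).subtype ∘ₗ LinearMap.proj c ∘ₗ f) :=
      hess c _ (by rintro _ ⟨x, rfl⟩; exact Subtype.property _) hatom.1
    have hEq := (hatom.le_iff_eq (isSimpleModule_iff_isAtom.mp (hsimple c)).1).mp hSc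
    refine ⟨hEq.symm, Subtype.ext ?_⟩
    rw [← hcomp c, hEq]
    exact e.symm.isotypicComponent_eq
  obtain ⟨e⟩ := hann.nonempty_equiv_of_isotypicComponent_eq (S c₀) T (hcomp c₀)
  let ψ : T →ₗ[A] ∀ c, X c :=
    LinearMap.single A (fun c => X c) c₀ ∘ₗ Submodule.inclusion (hle c₀) ∘ₗ e.symm.toLinearMap
  -- T occurs just once in the socle of ∏ X_c, so each map from T to the product factors through ψ.
  refine LinearMap.finrank_le_finrank_of_surjective (f := LinearMap.compRight k (M := T) ψ) ?_
  intro f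
  have hmem : ∀ x, (f x c₀ : A) ∈ S c₀ := by
    intro x
    by_cases h0 : LinearMap.proj c₀ ∘ₗ f = 0
    · have : f x c₀ = 0 := LinearMap.congr_fun h0 x
      rw [this]
      exact Submodule.zero_mem _
    · rw [← (hrange f c₀ h0).1]
      exact ⟨x, rfl⟩
  refine ⟨e.toLinearMap ∘ₗ LinearMap.codRestrict (S c₀)
    ((X c₀).subtype ∘ₗ (LinearMap.proj c₀ : (∀ c, X c) →ₗ[A] X c₀) ∘ₗ f) hmem, ?_⟩
  ext x c
  by_cases hc : c = c₀
  · subst hc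
    simp only [LinearMap.compRight_apply, ψ, LinearMap.comp_apply, LinearEquiv.coe_coe,
      LinearEquiv.symm_apply_apply, LinearMap.single_apply, Pi.single_eq_same]
    rfl
  · have h0 : f x c = 0 := by
      by_contra hne
      exact hc (hrange f c fun h => hne (LinearMap.congr_fun h x)).2
    simp [ψ, h0, Pi.single_eq_of_ne hc]

/-! ### Quasi-Frobenius algebras and embeddings -/

/-- If `T` is left self-injective and anti-isomorphic to a ring `R` whose left ideals are finitely
generated, then the left ideals of `R` are annihilators. -/
theorem leftIdealsAreAnnihilators_of_injective_opposite {R T : Type u} [Ring R] [Ring T]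
    [IsNoetherianRing R] (e : T ≃+* Rᵐᵒᵖ) (hT : Module.Injective T T) :
    LeftIdealsAreAnnihilators R := by
  intro K
  refine ⟨{x | ∀ a ∈ K, a * x = 0}, fun a => ⟨fun ha x hx => hx a ha, fun ha => ?_⟩⟩
  obtain ⟨n, y, hy⟩ := Submodule.fg_iff_exists_fin_generating_family.mp (IsNoetherian.noetherian K)
  let op : R → T := fun r => e.symm (MulOpposite.op r)
  have op_unop : ∀ t, op (e t).unop = t := fun t => by simp [op]
  have op_mul : ∀ r s, op (r * s) = op s * op r := fun r s => by simp [op]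
  have op_add : ∀ r s, op (r + s) = op r + op s := fun r s => by simp [op]
  have op_inj : Function.Injective op := e.symm.injective.comp MulOpposite.op_injective
  have op_zero : op 0 = 0 := by simp [op]
  let F : T →ₗ[T] (ULift.{u} (Fin n) → T) := LinearMap.pi fun j =>
    LinearMap.toSpanSingleton T T (op (y j.down))
  let G : T →ₗ[T] T := LinearMap.toSpanSingleton T T (op a)
  have hker : LinearMap.ker F ≤ LinearMap.ker G := by
    intro t ht
    have h1 : ∀ j, t * op (y j) = 0 := fun j => congrFun ht ⟨j⟩
    have h2 : ∀ j, y j * (e t).unop = 0 := fun j => op_inj (by rw [op_mul, op_unop, h1, op_zero])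
    have h3 : K ≤ LinearMap.ker (LinearMap.toSpanSingleton R R (e t).unop) := by
      rw [← hy, Submodule.span_le]
      rintro _ ⟨j, rfl⟩
      exact h2 j
    change t * op a = 0
    rw [← op_unop t, ← op_mul, ha _ fun b hb => h3 hb, op_zero]
  -- G factors through the image of F; extending to Tⁿ by injectivity expresses a through the
  -- generators of K.
  obtain ⟨g, hg⟩ := hT.out ((LinearMap.ker F).liftQ F le_rfl)
    (LinearMap.ker_eq_bot.mp (Submodule.ker_liftQ_eq_bot' _ _ rfl)) ((LinearMap.ker F).liftQ G hker)
  have hg1 : g (F 1) = op a := by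
    have := hg (Submodule.Quotient.mk 1)
    simpa [G] using this
  have hsum : op a = ∑ j, op (y j.down) * g (Pi.single j 1) := by
    rw [← hg1, ← LinearMap.sum_single_apply (fun _ => T) (F 1), map_sum]
    refine Finset.sum_congr rfl fun j _ => ?_
    have : (Pi.single j (F 1 j) : ULift.{u} (Fin n) → T) = op (y j.down) • Pi.single j 1 := by
      rw [← Pi.single_smul]
      simp [F]
    rw [this, map_smul, smul_eq_mul]
  have hsum' : a = ∑ j, (e (g (Pi.single j 1))).unop * y j.down := by
    apply op_inj
    let opHom : R →+ T := AddMonoidHom.mk' op op_add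
    have : op (∑ j, (e (g (Pi.single j 1))).unop * y j.down) =
        ∑ j, op ((e (g (Pi.single j 1))).unop * y j.down) := map_sum opHom _ _
    rw [this, hsum]
    exact Finset.sum_congr rfl fun j _ => by rw [op_mul, op_unop]
  rw [hsum']
  exact Submodule.sum_mem _ fun j _ => K.smul_mem _ (hy ▸ Submodule.subset_span ⟨j.down, rfl⟩)

/-- Take a map M → Aⁿ with minimal kernel. A simple submodule of the kernel embeds in A; extending
that embedding to M adds a coordinate that shrinks the kernel. -/
theorem LeftIdealsAreAnnihilators.embedsInFree {A : Type u} [Ring A] [IsArtinianRing A]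
    (hann : LeftIdealsAreAnnihilators A) (hinj : Module.Injective A A)
    (M : Type u) [AddCommGroup M] [Module A M] [Module.Finite A M] : EmbedsInFree A M := by
  obtain ⟨K, ⟨n, g, rfl⟩, hmin⟩ := IsArtinian.set_has_minimal
    {K : Submodule A M | ∃ (n : ℕ) (g : M →ₗ[A] (Fin n → A)), LinearMap.ker g = K}
    ⟨_, 0, 0, rfl⟩
  refine ⟨ULift.{u} (Fin n → A), inferInstance, inferInstance, inferInstance,
    ULift.moduleEquiv.symm.toLinearMap ∘ₗ g, ULift.moduleEquiv.symm.injective.comp ?_⟩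
  rw [← LinearMap.ker_eq_bot]
  refine (eq_bot_or_exists_atom_le (LinearMap.ker g)).resolve_right ?_
  rintro ⟨S, hS, hle⟩
  have := isSimpleModule_iff_isAtom.mpr hS
  obtain ⟨f, hf⟩ := hann.exists_injective S
  obtain ⟨h, hh⟩ := hinj.out S.subtype S.subtype_injective f
  refine hmin _ ⟨n + 1, LinearMap.pi (Fin.cons h fun j => LinearMap.proj j ∘ₗ g), rfl⟩ ?_
  have hmem : ∀ x, LinearMap.pi (Fin.cons h fun j => LinearMap.proj j ∘ₗ g :
      Fin (n + 1) → M →ₗ[A] A) x = 0 ↔ h x = 0 ∧ g x = 0 := fun x => by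
    simp [funext_iff, Fin.forall_fin_succ]
  refine lt_of_le_of_ne (fun x hx => ((hmem x).mp hx).2) fun hEq => hS.1 ?_
  rw [eq_bot_iff]
  intro x hx
  have h1 : h x = 0 := ((hmem x).mp (LinearMap.mem_ker.mp (hEq ▸ hle hx))).1
  have h2 : f ⟨x, hx⟩ = 0 := by rw [← hh, ← h1]; rfl
  exact congrArg Subtype.val ((map_eq_zero_iff f hf).mp h2)

theorem Module.Injective.opposite_self {R : Type u} [Ring R] (h : Module.Injective Rᵐᵒᵖ R) :
    Module.Injective Rᵐᵒᵖ Rᵐᵒᵖ := by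
  let e : R ≃ₗ[Rᵐᵒᵖ] Rᵐᵒᵖ :=
    { MulOpposite.opAddEquiv with
      map_smul' := fun r x => by
        simp [MulOpposite.smul_eq_mul_unop] }
  exact (Module.Baer.of_injective h).of_equiv e |>.injective

theorem IsQuasiFrobenius.leftIdealsAreAnnihilators (k : Type v) {A : Type u} [Field k] [Ring A]
    [Algebra k A] [FiniteDimensional k A] (h : IsQuasiFrobenius A) :
    LeftIdealsAreAnnihilators A := by
  have : IsNoetherianRing A := isNoetherian_of_tower k inferInstance
  have hfin : FiniteDimensional k Aᵐᵒᵖ := Module.Finite.equiv (MulOpposite.opLinearEquiv k)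
  have : IsNoetherianRing Aᵐᵒᵖ := isNoetherian_of_tower k inferInstance
  refine leftIdealsAreAnnihilators_of_injective_opposite (RingEquiv.refl Aᵐᵒᵖ) ?_
  rcases h.1 with hl | hr
  -- Left self-injectivity gives the annihilator condition for `Aᵐᵒᵖ`, which is therefore
  -- self-injective.
  · exact (leftIdealsAreAnnihilators_of_injective_opposite (RingEquiv.opOp A) hl).injective_self k
  · exact hr.opposite_self

theorem corollary3p6 {k : Type v} [Field k] {A : Type u} [Ring A] [Algebra k A]
    (hA : IsProfiniteAlgebra k A) :
    List.TFAE [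
      ∀ (M : Type u) [AddCommGroup M] [Module A M], Module.Finite A M → EmbedsInFree A M,
      ∀ (M : Type u) [AddCommGroup M] [Module A M],
        (∃ m : M, Submodule.span A {m} = ⊤) → EmbedsInFree A M,
      FiniteDimensional k A ∧ IsQuasiFrobenius A] := by
  tfae_have 1 → 2 := fun h M _ _ ⟨m, hm⟩ => h M ⟨⟨{m}, by simpa using hm⟩⟩
  tfae_have 2 → 3 := fun h => by
    have hann := leftIdealsAreAnnihilators_of_cyclic h
    have hfin := hA.finiteDimensional hann
    exact ⟨hfin, Or.inl (hann.injective_self k), Or.inl (isArtinian_of_tower k inferInstance)⟩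
  tfae_have 3 → 1 := fun ⟨hfin, hQF⟩ M _ _ hM => by
    have hann := hQF.leftIdealsAreAnnihilators k
    have : IsArtinianRing A := isArtinian_of_tower k inferInstance
    exact hann.embedsInFree (hann.injective_self k) M
  tfae_finish
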